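/- All digraphs are simple: they have no loops and no parallel arcs, but two opposite arcs between the same two vertices are allowed. An oriented tree of order $k$ is a digraph on $k$ vertices obtained from an undirected tree by giving each edge exactly one of its two directions. A digraph $D$ contains a digraph $H$ if there is an injective map from the vertices of $H$ to the vertices of $D$ that sends every arc of $H$ to an arc of $D$. The chromatic number $\chi(D)$ is the least number of colours in a colouring of the vertices of $D$ in which any two vertices joined by an arc have different colours ($\chi(D)=\infty$ if no finite number suffices). Theorem. Let $k\ge 1$ and let $T$ be an oriented tree of order $k$. Then every digraph $D$ with $$\chi(D)\ \ge\ 8\sqrt{\tfrac{2}{15}}\,k\sqrt{k}+\tfrac{11}{3}k+\sqrt{\tfrac56}\,\sqrt{k}+1$$ contains $T$. -/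

import Mathlib

universe v u

namespace Digraph

/-- A digraph is simple if it has no loops; parallel arcs do not exist in `Digraph`, and digons
(two opposite arcs) are allowed. -/
def IsSimple {V : Type*} (D : Digraph V) : Prop :=
  ∀ v, ¬ D.Adj v v

/-- An oriented graph: a digraph with no loops and no digons (take `v = w` for loops). -/
def IsOriented {V : Type*} (D : Digraph V) : Prop :=
  ∀ v w, D.Adj v w → ¬ D.Adj w v

/-- An oriented tree: an oriented graph whose underlying undirected graph is a tree. -/
structure IsOrientedTree {V : Type*} (T : Digraph V) : Prop where
  isOriented : T.IsOriented
  isTree : T.toSimpleGraphInclusive.IsTree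

/-- The chromatic number of a simple digraph: the least number of colours in a colouring of the
vertices where any two vertices joined by an arc, in either direction, get different colours
(`⊤` if no finite number of colours suffices). -/
noncomputable def chromaticNumber {V : Type*} (D : Digraph V) : ℕ∞ :=
  D.toSimpleGraphInclusive.chromaticNumber

/-- `D` contains `H` as a (not necessarily induced) subdigraph. -/
def Contains {V W : Type*} (D : Digraph V) (H : Digraph W) : Prop :=
  ∃ f : W → V, Function.Injective f ∧ ∀ v w, H.Adj v w → D.Adj (f v) (f w)

/-- `H` is `c`-universal if every simple digraph of chromatic number at least `c`
contains `H`. -/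
def IsUniversal {W : Type u} (H : Digraph W) (c : ℝ) : Prop :=
  ∀ (V : Type v) (D : Digraph V), D.IsSimple →
    ENNReal.ofReal c ≤ (D.chromaticNumber : ENNReal) → D.Contains H

end Digraph

/-!
Fix a digraph `r` on `V` and an oriented tree `t` on `W`, rooted at a vertex `o`. Since the
chromatic number is determined by finite parts (`chromaticNumber_le_of_col`), it suffices to show
that every finite set of vertices of `r` contains the tree or can be coloured with few colours
(`Unavoidable`). Two operations reduce the tree, which at each time consists of `k` vertices.

* All leaves are removed at once (`Unavoidable.of_sdiff_leaves`). The vertices with out-degree less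
  than `k` can be coloured with `2 k - 1` colours, and so can those with in-degree less than `k`.
  Once they are discarded, leaves are attached greedily. The cost is `4 k` colours.
* A pendant subtree `Y` of order `s` is removed (`IsPendant.unavoidable`), at the cost of
  `(k - 1) + s (s - 1)` colours. Three facts carry this. An acyclic digraph without a given tree of
  order `j` can be coloured with `j - 1` colours (`Acyc.exists_isEmb_or_col`). Every vertex outside
  a maximal acyclic set has both an in-neighbour and an out-neighbour in it
  (`exists_dominating_acyc`). In a maximal acyclic set `A`, the vertices that do not root a copy of
  `Y` inside `A` form a `Y`-free set, which costs only `s - 1` colours. Say that `Y` hangs at its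
  parent by an arc towards `Y`; the other case follows by reversing all arcs. Then only the vertices with no arc to a root of `Y` in `A` still
  need care, and one repeats the construction among them. After `s` rounds the remaining vertices
  are dominated by `s` maximal acyclic sets and root every tree of order `s + 1`. As no arc leads
  from later rounds to the roots of an earlier one, all roots together form an acyclic set, which
  costs at most `k - 1` colours. Everything used is removed, so that the rest of the tree, found
  among the remaining vertices, is disjoint from the copy of `Y` (`exists_absorbing`).

If the tree has `ℓ ≥ √(5 / 6) √k` leaves, removing them pays for `4 k` colours in the bound.
Otherwise the tree is cut into at most `ℓ + k / s` pendant pieces of order at most `s = ⌈√k⌉`, with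
total cost at most `(√(5 / 6) + 2) k √k`, and `√(5 / 6) + 2 ≤ 8 √(2 / 15)`.
-/

namespace OrientedTrees

open scoped Classical

variable {V W : Type*} {r : V → V → Prop} {t : W → W → Prop}

/-! ### Colourings, acyclic sets and embeddings -/

/-- `S` can be properly coloured with `n` colours, where the two ends of an arc of `r` inside `S`
must get different colours. -/
def Col (r : V → V → Prop) (S : Finset V) (n : ℕ) : Prop :=
  ∃ c : V → ℕ, (∀ x ∈ S, c x < n) ∧ ∀ x ∈ S, ∀ y ∈ S, r x y → c x ≠ c y

/-- `S` induces an acyclic digraph, expressed by a rank that decreases along arcs. Ranks are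
integers rather than naturals so that reversing all arcs amounts to negating the rank. -/
def Acyc (r : V → V → Prop) (S : Finset V) : Prop :=
  ∃ ρ : V → ℤ, ∀ x ∈ S, ∀ y ∈ S, r x y → ρ y < ρ x

/-- `f` embeds the subdigraph of `t` induced on `X` into the subdigraph of `r` induced on `S`;
the values of `f` outside `X` are irrelevant. -/
structure IsEmb (t : W → W → Prop) (r : V → V → Prop) (X : Finset W) (S : Finset V)
    (f : W → V) : Prop where
  mem : ∀ x ∈ X, f x ∈ S
  inj : ∀ x ∈ X, ∀ y ∈ X, f x = f y → x = y
  map : ∀ x ∈ X, ∀ y ∈ X, t x y → r (f x) (f y)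

lemma Col.mono {S S' : Finset V} {n n' : ℕ} (h : Col r S n) (hS : S' ⊆ S) (hn : n ≤ n') :
    Col r S' n' := by
  obtain ⟨c, h1, h2⟩ := h
  exact ⟨c, fun x hx => (h1 x (hS hx)).trans_le hn, fun x hx y hy => h2 x (hS hx) y (hS hy)⟩

lemma Col.union {S S' : Finset V} {n n' : ℕ} (h : Col r S n) (h' : Col r S' n') :
    Col r (S ∪ S') (n + n') := by
  obtain ⟨c, h1, h2⟩ := h
  obtain ⟨c', h1', h2'⟩ := h'
  have key : ∀ x ∈ S ∪ S', x ∉ S → x ∈ S' := by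
    intro x hx hxS
    rcases Finset.mem_union.1 hx with h | h
    · exact absurd h hxS
    · exact h
  refine ⟨fun x => if x ∈ S then c x else n + c' x, ?_, ?_⟩
  · intro x hx
    by_cases hxS : x ∈ S
    · simp only [hxS, if_true]
      have := h1 x hxS
      omega
    · simp only [hxS, if_false]
      have := h1' x (key x hx hxS)
      omega
  · intro x hx y hy hr
    by_cases hxS : x ∈ S <;> by_cases hyS : y ∈ S <;> simp only [hxS, hyS, if_true, if_false]
    · exact h2 x hxS y hyS hr
    · have := h1 x hxS
      omega
    · have := h1 y hyS
      omega
    · have := h2' x (key x hx hxS) y (key y hy hyS) hr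
      omega

lemma Col.empty (n : ℕ) : Col r (∅ : Finset V) n := ⟨fun _ => 0, by simp, by simp⟩

lemma Col.of_stable {S : Finset V} (h : ∀ x ∈ S, ∀ y ∈ S, ¬ r x y) : Col r S 1 :=
  ⟨fun _ => 0, fun _ _ => one_pos, fun x hx y hy hr => absurd hr (h x hx y hy)⟩

lemma Col.of_flip {S : Finset V} {n : ℕ} (h : Col (flip r) S n) : Col r S n := by
  obtain ⟨c, h1, h2⟩ := h
  exact ⟨c, h1, fun x hx y hy hr => (h2 y hy x hx hr).symm⟩

lemma Acyc.mono {S S' : Finset V} (h : Acyc r S) (hS : S' ⊆ S) : Acyc r S' := by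
  obtain ⟨ρ, h⟩ := h
  exact ⟨ρ, fun x hx y hy => h x (hS hx) y (hS hy)⟩

lemma Acyc.flip {S : Finset V} (h : Acyc r S) : Acyc (flip r) S := by
  obtain ⟨ρ, h⟩ := h
  exact ⟨fun x => - ρ x, fun x hx y hy hr => neg_lt_neg (h y hy x hx hr)⟩

/-- If no arc leads from `S'` back to `S`, the ranks of `S` can be shifted above those of `S'`. -/
lemma Acyc.union {S S' : Finset V} (h : Acyc r S) (h' : Acyc r S')
    (hn : ∀ x ∈ S', ∀ y ∈ S, ¬ r x y) : Acyc r (S ∪ S') := by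
  obtain ⟨ρ, h⟩ := h
  obtain ⟨ρ', h'⟩ := h'
  obtain ⟨m, hm⟩ := (S.image ρ).bddBelow
  obtain ⟨M, hM⟩ := (S'.image ρ').bddAbove
  have hm' : ∀ x ∈ S, m ≤ ρ x := fun x hx =>
    hm (Finset.mem_coe.2 (Finset.mem_image_of_mem ρ hx))
  have hM' : ∀ x ∈ S', ρ' x ≤ M := fun x hx =>
    hM (Finset.mem_coe.2 (Finset.mem_image_of_mem ρ' hx))
  have key : ∀ x ∈ S ∪ S', x ∉ S → x ∈ S' := by
    intro x hx hxS
    rcases Finset.mem_union.1 hx with h | h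
    · exact absurd h hxS
    · exact h
  refine ⟨fun x => if x ∈ S then ρ x + (M - m + 1) else ρ' x, ?_⟩
  intro x hx y hy hr
  by_cases hxS : x ∈ S <;> by_cases hyS : y ∈ S <;> simp only [hxS, hyS, if_true, if_false]
  · have := h x hxS y hyS hr
    omega
  · have := hm' x hxS
    have := hM' y (key y hy hyS)
    omega
  · exact absurd hr (hn x (key x hx hxS) y hyS)
  · exact h' x (key x hx hxS) y (key y hy hyS) hr

lemma Acyc.insert_sink {S : Finset V} (hirr : ∀ x, ¬ r x x) (h : Acyc r S) {v : V}
    (hn : ∀ y ∈ S, ¬ r v y) : Acyc r (insert v S) := by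
  have h1 : Acyc r {v} := ⟨fun _ => 0, by
    intro x hx y hy hr
    rw [Finset.mem_singleton] at hx hy
    subst hx
    subst hy
    exact absurd hr (hirr _)⟩
  rw [Finset.insert_eq, Finset.union_comm]
  refine h.union h1 ?_
  intro x hx y hy
  rw [Finset.mem_singleton] at hx
  subst hx
  exact hn y hy

/-- A vertex outside a maximal acyclic set could be added as a sink if it had no out-neighbour in
the set, and as a source if it had no in-neighbour there. -/
lemma exists_dominating_acyc (hirr : ∀ x, ¬ r x x) (S : Finset V) :
    ∃ A ⊆ S, Acyc r A ∧ ∀ v ∈ S \ A, (∃ a ∈ A, r v a) ∧ ∃ a ∈ A, r a v := by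
  have hne : (S.powerset.filter (fun A => Acyc r A)).Nonempty :=
    ⟨∅, Finset.mem_filter.2 ⟨Finset.empty_mem_powerset S, fun _ => 0, by simp⟩⟩
  obtain ⟨A, hA, hmax⟩ := Finset.exists_max_image _ Finset.card hne
  simp only [Finset.mem_filter, Finset.mem_powerset] at hA hmax
  refine ⟨A, hA.1, hA.2, ?_⟩
  intro v hv
  rw [Finset.mem_sdiff] at hv
  have hbad : ¬ Acyc r (insert v A) := by
    intro h
    have := hmax (insert v A) ⟨Finset.insert_subset hv.1 hA.1, h⟩
    rw [Finset.card_insert_of_notMem hv.2] at this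
    omega
  constructor
  · by_contra hcon
    push Not at hcon
    exact hbad (hA.2.insert_sink hirr hcon)
  · by_contra hcon
    push Not at hcon
    exact hbad (hA.2.flip.insert_sink (r := flip r) (fun x => hirr x) hcon).flip

/-- Every finite acyclic digraph has a kernel. -/
lemma Acyc.exists_kernel {S : Finset V} (h : Acyc r S) :
    ∃ K ⊆ S, (∀ x ∈ K, ∀ y ∈ K, ¬ r x y) ∧ ∀ x ∈ S \ K, ∃ y ∈ K, r x y := by
  obtain ⟨ρ, h⟩ := h
  induction S using Finset.strongInduction with
  | H S ih =>
    rcases S.eq_empty_or_nonempty with rfl | hne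
    · exact ⟨∅, by simp⟩
    obtain ⟨m, hm, hmin⟩ := Finset.exists_min_image S ρ hne
    have hout : ∀ y ∈ S, ¬ r m y := fun y hy hr => by
      have := h m hm y hy hr
      have := hmin y hy
      omega
    obtain ⟨K, hK, hst, hdom⟩ := ih ((S.erase m).filter (fun x => ¬ r x m))
      ((Finset.filter_subset _ _).trans_ssubset (Finset.erase_ssubset hm))
      (fun x hx y hy => h x (Finset.mem_of_mem_erase (Finset.mem_filter.1 hx).1) y
        (Finset.mem_of_mem_erase (Finset.mem_filter.1 hy).1))
    have hKS : K ⊆ S := fun x hx => Finset.mem_of_mem_erase (Finset.mem_filter.1 (hK hx)).1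
    refine ⟨insert m K, Finset.insert_subset hm hKS, ?_, ?_⟩
    · intro x hx y hy
      rcases Finset.mem_insert.1 hx with hx' | hx'
      · rw [hx']
        rcases Finset.mem_insert.1 hy with hy' | hy'
        · rw [hy']
          exact hout m hm
        · exact hout y (hKS hy')
      · rcases Finset.mem_insert.1 hy with hy' | hy'
        · rw [hy']
          exact (Finset.mem_filter.1 (hK hx')).2
        · exact hst x hx' y hy'
    · intro x hx
      rw [Finset.mem_sdiff, Finset.mem_insert, not_or] at hx
      by_cases hxm : r x m
      · exact ⟨m, Finset.mem_insert_self _ _, hxm⟩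
      · obtain ⟨y, hy, hr⟩ := hdom x (by
          rw [Finset.mem_sdiff, Finset.mem_filter, Finset.mem_erase]
          exact ⟨⟨⟨hx.2.1, hx.1⟩, hxm⟩, hx.2.2⟩)
        exact ⟨y, Finset.mem_insert_of_mem hy, hr⟩

lemma IsEmb.mono {X X' : Finset W} {S S' : Finset V} {f : W → V} (h : IsEmb t r X S f)
    (hX : X' ⊆ X) (hS : S ⊆ S') : IsEmb t r X' S' f :=
  ⟨fun x hx => hS (h.mem x (hX hx)), fun x hx y hy => h.inj x (hX hx) y (hX hy),
    fun x hx y hy => h.map x (hX hx) y (hX hy)⟩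

lemma IsEmb.of_flip {X : Finset W} {S : Finset V} {f : W → V}
    (h : IsEmb (flip t) (flip r) X S f) : IsEmb t r X S f :=
  ⟨h.mem, h.inj, fun x hx y hy => h.map y hy x hx⟩

lemma IsEmb.singleton (hirr : ∀ x, ¬ t x x) (q : W) {S : Finset V} {v : V} (hv : v ∈ S) :
    IsEmb t r {q} S (fun _ => v) := by
  refine ⟨fun _ _ => hv, ?_, ?_⟩
  · intro x hx y hy _
    rw [Finset.mem_singleton] at hx hy
    rw [hx, hy]
  · intro x hx y hy ht
    rw [Finset.mem_singleton] at hx hy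
    rw [hx, hy] at ht
    exact absurd ht (hirr q)

/-- Extending an embedding by one vertex `x`, placed at a free vertex `w`. -/
lemma IsEmb.insert_vertex {Z : Finset W} {S : Finset V} {f : W → V} (h : IsEmb t r Z S f)
    (hirr : ∀ x, ¬ t x x) {x : W} {w : V} (hx : x ∉ Z) (hw : w ∈ S) (hfree : ∀ z ∈ Z, f z ≠ w)
    (hout : ∀ y ∈ Z, t x y → r w (f y)) (hin : ∀ y ∈ Z, t y x → r (f y) w) :
    IsEmb t r (insert x Z) S (Function.update f x w) := by
  have hne : ∀ z ∈ Z, Function.update f x w z = f z := fun z hz =>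
    Function.update_of_ne (ne_of_mem_of_not_mem hz hx) _ _
  refine ⟨?_, ?_, ?_⟩
  · intro z hz
    rcases Finset.mem_insert.1 hz with rfl | hz'
    · simpa using hw
    · rw [hne z hz']
      exact h.mem z hz'
  · intro y hy z hz
    rcases Finset.mem_insert.1 hy with hy' | hy' <;> rcases Finset.mem_insert.1 hz with hz' | hz'
    · exact fun _ => hy'.trans hz'.symm
    · rw [hne z hz', hy', Function.update_self]
      exact fun h => absurd h.symm (hfree z hz')
    · rw [hne y hy', hz', Function.update_self]
      exact fun h => absurd h (hfree y hy')
    · rw [hne y hy', hne z hz']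
      exact h.inj y hy' z hz'
  · intro y hy z hz
    rcases Finset.mem_insert.1 hy with hy' | hy' <;> rcases Finset.mem_insert.1 hz with hz' | hz'
    · rw [hy', hz']
      exact fun h => absurd h (hirr _)
    · rw [hne z hz', hy', Function.update_self]
      exact hout z hz'
    · rw [hne y hy', hz', Function.update_self]
      exact hin y hy'
    · rw [hne y hy', hne z hz']
      exact h.map y hy' z hz'

/-! ### Rooted oriented trees -/

/-- The relation `t` is an oriented tree rooted at `o`: `p` is the parent map, `d` a depth function,
and every arc of `t` joins a vertex to its parent, in one of the two directions. The value `p o` is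
irrelevant. That a vertex is actually joined to its parent is never needed. -/
structure IsRooted (t : W → W → Prop) (o : W) (p : W → W) (d : W → ℕ) : Prop where
  asymm : ∀ x y, t x y → ¬ t y x
  depth_lt : ∀ x, x ≠ o → d (p x) < d x
  edge : ∀ x y, t x y → (y ≠ o ∧ x = p y) ∨ (x ≠ o ∧ y = p x)

/-- `Z` is the vertex set of a subtree with top vertex `q`: it is closed under taking parents, except
at `q`. -/
structure IsSubtree (o : W) (p : W → W) (q : W) (Z : Finset W) : Prop where
  top_mem : q ∈ Z
  ne_root : ∀ x ∈ Z, x ≠ q → x ≠ o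
  parent_mem : ∀ x ∈ Z, x ≠ q → p x ∈ Z

variable {o : W} {p : W → W} {d : W → ℕ}

lemma IsRooted.irrefl (ht : IsRooted t o p d) (x : W) : ¬ t x x := fun h => ht.asymm x x h h

lemma IsRooted.flip (ht : IsRooted t o p d) : IsRooted (flip t) o p d :=
  ⟨fun x y h => ht.asymm y x h, ht.depth_lt, fun x y h => (ht.edge y x h).symm⟩

lemma IsSubtree.depth_le (ht : IsRooted t o p d) {q : W} {Z : Finset W}
    (hZ : IsSubtree o p q Z) : ∀ x ∈ Z, d q ≤ d x := by
  obtain ⟨m, hm, hmin⟩ := Finset.exists_min_image Z d ⟨q, hZ.top_mem⟩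
  have hmq : m = q := by
    by_contra hne
    have h1 := ht.depth_lt m (hZ.ne_root m hm hne)
    have h2 := hmin _ (hZ.parent_mem m hm hne)
    omega
  subst hmq
  exact hmin

/-- A subtree that is not a single vertex has a leaf other than its top: a deepest vertex. -/
lemma IsSubtree.exists_leaf (ht : IsRooted t o p d) {q : W} {Z : Finset W}
    (hZ : IsSubtree o p q Z) (hne : Z ≠ {q}) :
    ∃ x ∈ Z, x ≠ q ∧ IsSubtree o p q (Z.erase x) ∧ p x ∈ Z.erase x ∧
      ∀ y ∈ Z.erase x, t x y ∨ t y x → y = p x := by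
  have hne' : (Z.erase q).Nonempty := by
    rw [Finset.nonempty_iff_ne_empty]
    intro h
    rw [Finset.erase_eq_empty_iff] at h
    rcases h with h | h
    · exact absurd hZ.top_mem (by simp [h])
    · exact hne h
  obtain ⟨x, hx, hmax⟩ := Finset.exists_max_image (Z.erase q) d hne'
  rw [Finset.mem_erase] at hx
  have hxo := hZ.ne_root x hx.2 hx.1
  have hchild : ∀ y ∈ Z, y ≠ q → p y ≠ x := by
    intro y hy hyq h
    have h1 := ht.depth_lt y (hZ.ne_root y hy hyq)
    have h2 := hmax y (Finset.mem_erase.2 ⟨hyq, hy⟩)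
    rw [h] at h1
    omega
  have hpx : p x ∈ Z.erase x := by
    refine Finset.mem_erase.2 ⟨fun h => ?_, hZ.parent_mem x hx.2 hx.1⟩
    have := ht.depth_lt x hxo
    rw [h] at this
    omega
  refine ⟨x, hx.2, hx.1, ⟨?_, ?_, ?_⟩, hpx, ?_⟩
  · exact Finset.mem_erase.2 ⟨fun h => hx.1 h.symm, hZ.top_mem⟩
  · exact fun y hy => hZ.ne_root y (Finset.mem_of_mem_erase hy)
  · intro y hy hyq
    exact Finset.mem_erase.2 ⟨hchild y (Finset.mem_of_mem_erase hy) hyq,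
      hZ.parent_mem y (Finset.mem_of_mem_erase hy) hyq⟩
  · intro y hy hxy
    have hyZ := Finset.mem_of_mem_erase hy
    -- The parent of the top has smaller depth, so it is not in the subtree.
    have hnot : y ≠ o → x ≠ p y := by
      intro hyo h
      by_cases hyq : y = q
      · have h1 := ht.depth_lt y hyo
        have h2 := hZ.depth_le ht x hx.2
        rw [← h, hyq] at h1
        omega
      · exact hchild y hyZ hyq h.symm
    rcases hxy with h | h
    · rcases ht.edge x y h with h | h
      · exact absurd h.2 (hnot h.1)
      · exact h.2
    · rcases ht.edge y x h with h | h
      · exact h.2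
      · exact absurd h.2 (hnot h.1)

/-- A leaf `x` is added to an embedding of the rest of a subtree. -/
lemma IsEmb.insert_leaf (ht : IsRooted t o p d) {Z : Finset W} {S : Finset V} {f : W → V} {x : W}
    {w : V} (h : IsEmb t r (Z.erase x) S f) (hx : x ∈ Z)
    (hnbr : ∀ y ∈ Z.erase x, t x y ∨ t y x → y = p x) (hw : w ∈ S)
    (hfree : ∀ z ∈ Z.erase x, f z ≠ w) (hout : t x (p x) → r w (f (p x)))
    (hin : t (p x) x → r (f (p x)) w) : IsEmb t r Z S (Function.update f x w) := by
  have := h.insert_vertex ht.irrefl (Finset.notMem_erase x Z) hw hfree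
    (fun y hy hxy => by
      have := hnbr y hy (Or.inl hxy)
      subst this
      exact hout hxy)
    (fun y hy hxy => by
      have := hnbr y hy (Or.inr hxy)
      subst this
      exact hin hxy)
  rwa [Finset.insert_erase hx] at this

/-- An acyclic digraph that needs at least `k` colours contains every oriented tree of order `k`:
a kernel supplies a leaf for every vertex outside it, at the price of one colour. -/
lemma Acyc.exists_isEmb_or_col (ht : IsRooted t o p d) {q : W} {Z : Finset W}
    (hZ : IsSubtree o p q Z) {S : Finset V} (hS : Acyc r S) :
    (∃ f, IsEmb t r Z S f) ∨ Col r S (Z.card - 1) := by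
  induction hn : Z.card generalizing Z S with
  | zero =>
    rw [Finset.card_eq_zero] at hn
    exact absurd hZ.top_mem (by simp [hn])
  | succ n ih =>
    by_cases hne : Z = {q}
    · rcases S.eq_empty_or_nonempty with rfl | ⟨v, hv⟩
      · exact Or.inr (Col.empty _)
      · subst hne
        exact Or.inl ⟨_, IsEmb.singleton ht.irrefl q hv⟩
    obtain ⟨x, hxZ, hxq, hZ', hpx, hnbr⟩ := hZ.exists_leaf ht hne
    have hcard : (Z.erase x).card = n := by
      rw [Finset.card_erase_of_mem hxZ, hn]
      rfl
    have hpos : 0 < n := by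
      rw [← hcard]
      exact Finset.card_pos.2 ⟨_, hpx⟩
    obtain ⟨K, hK, hst, hdom⟩ : ∃ K ⊆ S, (∀ x ∈ K, ∀ y ∈ K, ¬ r x y) ∧
        ∀ v ∈ S \ K, ∃ w ∈ K, (t x (p x) → r w v) ∧ (t (p x) x → r v w) := by
      by_cases hdir : t x (p x)
      · obtain ⟨K, hK, hst, hdom⟩ := hS.flip.exists_kernel
        refine ⟨K, hK, fun x hx y hy => hst y hy x hx, fun v hv => ?_⟩
        obtain ⟨w, hw, hr⟩ := hdom v hv
        exact ⟨w, hw, fun _ => hr, fun h => absurd h (ht.asymm _ _ hdir)⟩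
      · obtain ⟨K, hK, hst, hdom⟩ := hS.exists_kernel
        refine ⟨K, hK, hst, fun v hv => ?_⟩
        obtain ⟨w, hw, hr⟩ := hdom v hv
        exact ⟨w, hw, fun h => absurd h hdir, fun _ => hr⟩
    rcases ih hZ' (hS.mono (Finset.sdiff_subset (s := S) (t := K))) hcard with ⟨f, hf⟩ | hcol
    · obtain ⟨w, hw, h1, h2⟩ := hdom _ (hf.mem _ hpx)
      refine Or.inl ⟨_, (hf.mono subset_rfl Finset.sdiff_subset).insert_leaf ht hxZ hnbr
        (hK hw) ?_ h1 h2⟩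
      intro z hz h
      have := hf.mem z hz
      rw [h, Finset.mem_sdiff] at this
      exact this.2 hw
    · right
      have := hcol.union (Col.of_stable hst)
      rw [Finset.sdiff_union_of_subset hK] at this
      exact this.mono subset_rfl (by omega)

/-! ### Attaching a pendant subtree -/

/-- The heart of the argument. Each stage takes a maximal acyclic set `A` of the current set; its
vertices `G₀` that root the subtree `Y` inside `A` are set aside, and the others are `Y`-free, hence
cheap to colour. A vertex with an arc to `G₀` is served, and the next stage continues with the
vertices without such an arc; this is why all the sets `G₀` together remain acyclic. A vertex that
survives `n` stages has neighbours of both kinds in each of the `n` maximal acyclic sets, and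
therefore roots every oriented tree of order at most `n + 1`. -/
lemma exists_absorbing_of_arc (ht : IsRooted t o p d) (hirr : ∀ x, ¬ r x x) {q : W} {Y : Finset W}
    (hY : IsSubtree o p q Y) (n : ℕ) (S : Finset V) :
    ∃ P ⊆ S, ∃ G ⊆ P, Acyc r G ∧ Col r (P \ G) (n * (Y.card - 1)) ∧ ∀ v ∈ S \ P,
      (∃ f, IsEmb t r Y P f ∧ r v (f q)) ∨
      ∀ q' Z, IsSubtree o p q' Z → Z.card ≤ n + 1 → ∃ f, IsEmb t r Z (insert v P) f ∧ f q' = v := by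
  induction n generalizing S with
  | zero =>
    refine ⟨∅, by simp, ∅, by simp, ⟨fun _ => 0, by simp⟩, by simpa using Col.empty _, ?_⟩
    intro v _
    right
    intro q' Z hZ hcard
    have : Z = {q'} := Finset.eq_singleton_iff_unique_mem.2
      ⟨hZ.top_mem, fun x hx => Finset.card_le_one.1 hcard x hx q' hZ.top_mem⟩
    subst this
    exact ⟨_, IsEmb.singleton ht.irrefl q' (Finset.mem_insert_self v ∅), rfl⟩
  | succ n ih =>
    obtain ⟨A, hAS, hA, hdom⟩ := exists_dominating_acyc hirr S
    set G₀ := A.filter (fun g => ∃ f, IsEmb t r Y A f ∧ f q = g) with hG₀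
    obtain ⟨P', hP', G', hG', hacyc, hcol, hserved⟩ :=
      ih ((S \ A).filter (fun v => ∀ g ∈ G₀, ¬ r v g))
    have hGA : G₀ ⊆ A := Finset.filter_subset _ _
    have hP'S : ∀ x ∈ P', x ∈ S ∧ x ∉ A := fun x hx =>
      Finset.mem_sdiff.1 (Finset.mem_filter.1 (hP' hx)).1
    have hcol₀ : Col r (A \ G₀) (Y.card - 1) := by
      rcases (hA.mono (Finset.sdiff_subset (s := A) (t := G₀))).exists_isEmb_or_col ht hY with
        ⟨f, hf⟩ | h
      · have hq := Finset.mem_sdiff.1 (hf.mem q hY.top_mem)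
        exact absurd (Finset.mem_filter.2 ⟨hq.1, f, hf.mono subset_rfl Finset.sdiff_subset, rfl⟩)
          hq.2
      · exact h
    refine ⟨A ∪ P', Finset.union_subset hAS fun x hx => (hP'S x hx).1, G₀ ∪ G',
      Finset.union_subset_union hGA hG', ?_, ?_, ?_⟩
    · exact (hA.mono hGA).union hacyc fun x hx => (Finset.mem_filter.1 (hP' (hG' hx))).2
    · refine (hcol₀.union hcol).mono ?_ (by rw [Nat.succ_mul, add_comm])
      intro x hx
      simp only [Finset.mem_sdiff, Finset.mem_union] at hx ⊢
      tauto
    · intro v hv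
      rw [Finset.mem_sdiff, Finset.mem_union, not_or] at hv
      by_cases hvG : ∃ g ∈ G₀, r v g
      · left
        obtain ⟨g, hg, hr⟩ := hvG
        obtain ⟨f, hf, rfl⟩ := (Finset.mem_filter.1 hg).2
        exact ⟨f, hf.mono subset_rfl Finset.subset_union_left, hr⟩
      push Not at hvG
      have hvS' : v ∈ (S \ A).filter (fun v => ∀ g ∈ G₀, ¬ r v g) :=
        Finset.mem_filter.2 ⟨Finset.mem_sdiff.2 ⟨hv.1, hv.2.1⟩, hvG⟩
      rcases hserved v (Finset.mem_sdiff.2 ⟨hvS', hv.2.2⟩) with ⟨f, hf, hr⟩ | h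
      · exact Or.inl ⟨f, hf.mono subset_rfl Finset.subset_union_right, hr⟩
      right
      intro q' Z hZ hcard
      by_cases hne : Z = {q'}
      · subst hne
        exact ⟨_, IsEmb.singleton ht.irrefl q' (Finset.mem_insert_self v _), rfl⟩
      obtain ⟨x, hxZ, hxq, hZ', hpx, hnbr⟩ := hZ.exists_leaf ht hne
      obtain ⟨f, hf, hfq⟩ := h q' _ hZ' (by rw [Finset.card_erase_of_mem hxZ]; omega)
      have hout : ∀ z ∈ Z.erase x, f z ∈ S \ A := by
        intro z hz
        rcases Finset.mem_insert.1 (hf.mem z hz) with h | h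
        · rw [h]
          exact Finset.mem_sdiff.2 ⟨hv.1, hv.2.1⟩
        · exact Finset.mem_sdiff.2 (hP'S _ h)
      obtain ⟨w, hw, h1, h2⟩ : ∃ w ∈ A, (t x (p x) → r w (f (p x))) ∧
          (t (p x) x → r (f (p x)) w) := by
        obtain ⟨⟨a, ha, hra⟩, b, hb, hrb⟩ := hdom _ (hout _ hpx)
        by_cases hdir : t x (p x)
        · exact ⟨b, hb, fun _ => hrb, fun h => absurd h (ht.asymm _ _ hdir)⟩
        · exact ⟨a, ha, fun h => absurd h hdir, fun _ => hra⟩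
      refine ⟨_, (hf.mono subset_rfl (Finset.insert_subset_insert _
        Finset.subset_union_right)).insert_leaf ht hxZ hnbr
        (Finset.mem_insert_of_mem (Finset.mem_union_left _ hw)) ?_ h1 h2, ?_⟩
      · intro z hz h
        have := Finset.mem_sdiff.1 (hout z hz)
        rw [h] at this
        exact this.2 hw
      · rw [Function.update_of_ne (Ne.symm hxq), hfq]

/-- Outside a set `P` that is the union of an acyclic set and a set with few colours, every vertex
can play the parent of `q` for a copy of `Y` inside `P`. -/
lemma exists_absorbing (ht : IsRooted t o p d) (hirr : ∀ x, ¬ r x x) {q : W} {Y : Finset W}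
    (hY : IsSubtree o p q Y) (hqo : q ≠ o) (S : Finset V) :
    ∃ P ⊆ S, ∃ G ⊆ P, Acyc r G ∧ Col r (P \ G) (Y.card * (Y.card - 1)) ∧ ∀ v ∈ S \ P,
      ∃ f, IsEmb t r Y P f ∧ (t (p q) q → r v (f q)) ∧ (t q (p q) → r (f q) v) := by
  -- The parent of `q` together with `Y` is a subtree of order `|Y| + 1`.
  have hpq : p q ∉ Y := fun h => by
    have h1 := hY.depth_le ht _ h
    have h2 := ht.depth_lt q hqo
    omega
  have hsub : IsSubtree o p (p q) (insert (p q) Y) := by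
    refine ⟨Finset.mem_insert_self _ _, ?_, ?_⟩
    · intro x hx hxp
      rcases Finset.mem_insert.1 hx with h | h
      · exact absurd h hxp
      · by_cases hxq : x = q
        · rwa [hxq]
        · exact hY.ne_root x h hxq
    · intro x hx hxp
      rcases Finset.mem_insert.1 hx with h | h
      · exact absurd h hxp
      · by_cases hxq : x = q
        · rw [hxq]
          exact Finset.mem_insert_self _ _
        · exact Finset.mem_insert_of_mem (hY.parent_mem x h hxq)
  have hcard : (insert (p q) Y).card ≤ Y.card + 1 := Finset.card_insert_le _ _
  have hrich : ∀ {P : Finset V} {v : V} {f : W → V}, IsEmb t r (insert (p q) Y) (insert v P) f →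
      f (p q) = v → ∃ f, IsEmb t r Y P f ∧ (t (p q) q → r v (f q)) ∧ (t q (p q) → r (f q) v) := by
    intro P v f hf hfv
    have hqm : q ∈ insert (p q) Y := Finset.mem_insert_of_mem hY.top_mem
    have hpm : p q ∈ insert (p q) Y := Finset.mem_insert_self _ _
    have hf' := hf.mono (Finset.subset_insert (p q) Y) subset_rfl
    refine ⟨f, ⟨fun x hx => ?_, hf'.inj, hf'.map⟩, ?_, ?_⟩
    · rcases Finset.mem_insert.1 (hf'.mem x hx) with h | h
      · rw [← hfv] at h
        have := hf.inj x (Finset.mem_insert_of_mem hx) _ hpm h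
        exact absurd (this ▸ hx) hpq
      · exact h
    · rw [← hfv]
      exact hf.map _ hpm _ hqm
    · rw [← hfv]
      exact hf.map _ hqm _ hpm
  by_cases hdir : t (p q) q
  · obtain ⟨P, hP, G, hG, hac, hcol, h⟩ := exists_absorbing_of_arc ht hirr hY Y.card S
    refine ⟨P, hP, G, hG, hac, hcol, fun v hv => ?_⟩
    rcases h v hv with ⟨f, hf, hr⟩ | h
    · exact ⟨f, hf, fun _ => hr, fun h => absurd h (ht.asymm _ _ hdir)⟩
    · obtain ⟨f, hf, hfv⟩ := h _ _ hsub hcard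
      exact hrich hf hfv
  · obtain ⟨P, hP, G, hG, hac, hcol, h⟩ :=
      exists_absorbing_of_arc (r := flip r) ht.flip (fun x => hirr x) hY Y.card S
    refine ⟨P, hP, G, hG, hac.flip, hcol.of_flip, fun v hv => ?_⟩
    rcases h v hv with ⟨f, hf, hr⟩ | h
    · exact ⟨f, hf.of_flip, fun h => absurd h hdir, fun _ => hr⟩
    · obtain ⟨f, hf, hfv⟩ := h _ _ hsub hcard
      exact hrich hf.of_flip hfv

/-- `Y` is a pendant part of the subtree `X` with root `o`: what hangs below the vertex `q`. -/
structure IsPendant (o : W) (p : W → W) (X : Finset W) (q : W) (Y : Finset W) : Prop where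
  subset : Y ⊆ X
  top_ne : q ≠ o
  subtree : IsSubtree o p q Y
  child_mem : ∀ x ∈ X, x ≠ o → p x ∈ Y → x ∈ Y

lemma IsPendant.root_notMem {X Y : Finset W} {q : W} (h : IsPendant o p X q Y) : o ∉ Y := by
  intro ho
  by_cases hq : o = q
  · exact h.top_ne hq.symm
  · exact h.subtree.ne_root o ho hq rfl

lemma IsPendant.parent_notMem (ht : IsRooted t o p d) {X Y : Finset W} {q : W}
    (h : IsPendant o p X q Y) : p q ∉ Y := fun hm => by
  have h1 := h.subtree.depth_le ht _ hm
  have h2 := ht.depth_lt q h.top_ne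
  omega

lemma IsPendant.sdiff {X Y : Finset W} {q : W} (hX : IsSubtree o p o X)
    (h : IsPendant o p X q Y) : IsSubtree o p o (X \ Y) := by
  refine ⟨Finset.mem_sdiff.2 ⟨hX.top_mem, h.root_notMem⟩, fun x _ hx => hx, ?_⟩
  intro x hx hxo
  rw [Finset.mem_sdiff] at hx ⊢
  exact ⟨hX.parent_mem x hx.1 hxo, fun hp => hx.2 (h.child_mem x hx.1 hxo hp)⟩

/-- Every finite set of vertices of `r` contains a copy of `X` or can be coloured with `n`
colours. -/
def Unavoidable (t : W → W → Prop) (r : V → V → Prop) (X : Finset W) (n : ℕ) : Prop :=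
  ∀ S : Finset V, (∃ f, IsEmb t r X S f) ∨ Col r S n

lemma Unavoidable.mono {X : Finset W} {n n' : ℕ} (h : Unavoidable t r X n) (hn : n ≤ n') :
    Unavoidable t r X n' := fun S => (h S).imp id fun hc => hc.mono subset_rfl hn

/-- Attaching a pendant subtree of order `s` costs `|X| - 1` colours for the acyclic part of the
absorbing set and `s (s - 1)` for the rest of it. -/
lemma IsPendant.unavoidable (ht : IsRooted t o p d) (hirr : ∀ x, ¬ r x x) {X Y : Finset W} {q : W}
    (hX : IsSubtree o p o X) (hY : IsPendant o p X q Y) {n : ℕ}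
    (h : Unavoidable t r (X \ Y) n) :
    Unavoidable t r X (n + (X.card - 1) + Y.card * (Y.card - 1)) := by
  intro S
  obtain ⟨P, hPS, G, hGP, hac, hcol, hserved⟩ := exists_absorbing ht hirr hY.subtree hY.top_ne S
  have hX' := hY.sdiff hX
  rcases hac.exists_isEmb_or_col ht hX with ⟨f, hf⟩ | hcolG
  · exact Or.inl ⟨f, hf.mono subset_rfl (hGP.trans hPS)⟩
  rcases h (S \ P) with ⟨f, hf⟩ | hcol'
  swap
  · right
    refine ((hcol'.union hcolG).union hcol).mono ?_ le_rfl
    intro x hx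
    simp only [Finset.mem_union, Finset.mem_sdiff]
    tauto
  left
  have hqX : q ∈ X := hY.subset hY.subtree.top_mem
  have hpq : p q ∈ X \ Y :=
    Finset.mem_sdiff.2 ⟨hX.parent_mem q hqX hY.top_ne, hY.parent_notMem ht⟩
  obtain ⟨g, hg, h1, h2⟩ := hserved _ (hf.mem _ hpq)
  have hsplit : ∀ x ∈ X, x ∉ Y → x ∈ X \ Y := fun x hx hxY => Finset.mem_sdiff.2 ⟨hx, hxY⟩
  have hfP : ∀ x ∈ X, x ∉ Y → f x ∉ P := fun x hx hxY =>
    (Finset.mem_sdiff.1 (hf.mem x (hsplit x hx hxY))).2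
  -- The only edge between `Y` and the rest of `X` is the one above `q`.
  have hlink : ∀ x ∈ X, x ∉ Y → ∀ y ∈ Y, t x y ∨ t y x → x = p q ∧ y = q := by
    intro x hx hxY y hy hxy
    have key : (y ≠ o ∧ x = p y) ∨ (x ≠ o ∧ y = p x) := by
      rcases hxy with h | h
      · exact ht.edge x y h
      · exact (ht.edge y x h).symm
    rcases key with ⟨_, h⟩ | ⟨hxo, h⟩
    · by_cases hyq : y = q
      · exact ⟨hyq ▸ h, hyq⟩
      · exact absurd (h ▸ hY.subtree.parent_mem y hy hyq) hxY
    · exact absurd (hY.child_mem x hx hxo (h ▸ hy)) hxY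
  refine ⟨fun x => if x ∈ Y then g x else f x, ?_, ?_, ?_⟩
  · intro x hx
    by_cases hxY : x ∈ Y
    · simp only [hxY, if_true]
      exact hPS (hg.mem x hxY)
    · simp only [hxY, if_false]
      exact (Finset.mem_sdiff.1 (hf.mem x (hsplit x hx hxY))).1
  · intro x hx y hy
    by_cases hxY : x ∈ Y <;> by_cases hyY : y ∈ Y <;> simp only [hxY, hyY, if_true, if_false]
    · exact hg.inj x hxY y hyY
    · exact fun h => absurd (h ▸ hg.mem x hxY) (hfP y hy hyY)
    · exact fun h => absurd (h ▸ hg.mem y hyY) (hfP x hx hxY)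
    · exact hf.inj x (hsplit x hx hxY) y (hsplit y hy hyY)
  · intro x hx y hy hxy
    by_cases hxY : x ∈ Y <;> by_cases hyY : y ∈ Y <;> simp only [hxY, hyY, if_true, if_false]
    · exact hg.map x hxY y hyY hxy
    · obtain ⟨rfl, rfl⟩ := hlink y hy hyY x hxY (Or.inr hxy)
      exact h2 hxy
    · obtain ⟨rfl, rfl⟩ := hlink x hx hxY y hyY (Or.inl hxy)
      exact h1 hxy
    · exact hf.map x (hsplit x hx hxY) y (hsplit y hy hyY) hxy

/-! ### Attaching all leaves at once -/

/-- If all out-degrees in `S` are at most `n`, then some in-degree is at most `n`, so that `S` can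
be coloured greedily with `2 n + 1` colours. -/
lemma Col.of_outdegree_le (hirr : ∀ x, ¬ r x x) {n : ℕ} (S : Finset V)
    (h : ∀ x ∈ S, (S.filter (r x)).card ≤ n) : Col r S (2 * n + 1) := by
  induction hm : S.card generalizing S with
  | zero =>
    rw [Finset.card_eq_zero] at hm
    subst hm
    exact Col.empty _
  | succ m ih =>
    have hne : S.Nonempty := Finset.card_pos.1 (by omega)
    obtain ⟨x, hx, hin⟩ : ∃ x ∈ S, (S.filter (fun y => r y x)).card ≤ n := by
      by_contra hcon
      push Not at hcon
      have h1 := Finset.sum_lt_sum_of_nonempty hne hcon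
      have h2 := Finset.sum_le_sum h
      have h3 : ∑ x ∈ S, (S.filter (r x)).card = ∑ x ∈ S, (S.filter (fun y => r y x)).card :=
        Finset.sum_card_bipartiteAbove_eq_sum_card_bipartiteBelow r
      rw [← h3] at h1
      exact absurd h1 (not_lt.2 h2)
    obtain ⟨c, hc1, hc2⟩ := ih (S.erase x) (fun y hy =>
      (Finset.card_le_card (Finset.filter_subset_filter _ (Finset.erase_subset _ _))).trans
        (h y (Finset.mem_of_mem_erase hy))) (by rw [Finset.card_erase_of_mem hx]; omega)
    set N := (S.filter (r x)) ∪ (S.filter (fun y => r y x)) with hN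
    have hNcard : (N.image c).card < (Finset.range (2 * n + 1)).card := by
      have h1 : (N.image c).card ≤ N.card := Finset.card_image_le
      have h2 := Finset.card_union_le (S.filter (r x)) (S.filter (fun y => r y x))
      have h3 := h x hx
      rw [← hN] at h2
      rw [Finset.card_range]
      omega
    obtain ⟨a, ha, haN⟩ := Finset.exists_mem_notMem_of_card_lt_card hNcard
    rw [Finset.mem_range] at ha
    have hfresh : ∀ y ∈ S, r x y ∨ r y x → a ≠ c y := by
      intro y hy hxy h
      refine haN (Finset.mem_image.2 ⟨y, ?_, h.symm⟩)
      rcases hxy with h | h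
      · exact Finset.mem_union_left _ (Finset.mem_filter.2 ⟨hy, h⟩)
      · exact Finset.mem_union_right _ (Finset.mem_filter.2 ⟨hy, h⟩)
    refine ⟨Function.update c x a, ?_, ?_⟩
    · intro y hy
      by_cases hyx : y = x
      · rwa [hyx, Function.update_self]
      · rw [Function.update_of_ne hyx]
        exact hc1 y (Finset.mem_erase.2 ⟨hyx, hy⟩)
    · intro y hy z hz hyz
      by_cases hyx : y = x <;> by_cases hzx : z = x
      · rw [hyx, hzx] at hyz
        exact absurd hyz (hirr x)
      · rw [hyx, Function.update_self, Function.update_of_ne hzx]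
        exact hfresh z hz (Or.inl (hyx ▸ hyz))
      · rw [hzx, Function.update_self, Function.update_of_ne hyx]
        exact (hfresh y hy (Or.inr (hzx ▸ hyz))).symm
      · rw [Function.update_of_ne hzx, Function.update_of_ne hyx]
        exact hc2 y (Finset.mem_erase.2 ⟨hyx, hy⟩) z (Finset.mem_erase.2 ⟨hzx, hz⟩) hyz

/-- All leaves of an oriented tree can be attached at once at the price of `4 |X|` colours, since
the vertices with out-degree less than `|X|`, and those with in-degree less than `|X|`, can be
coloured with few colours. Here `L` is a set of leaves of `X` other than the root. -/
lemma Unavoidable.of_sdiff_leaves (ht : IsRooted t o p d) (hirr : ∀ x, ¬ r x x) {X L : Finset W}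
    (hX' : IsSubtree o p o (X \ L)) (hLX : L ⊆ X) (hL : ∀ x ∈ L, x ≠ o ∧ p x ∈ X \ L) {n : ℕ}
    (h : Unavoidable t r (X \ L) n) : Unavoidable t r X (n + 4 * X.card) := by
  intro S
  have hpos : 0 < X.card :=
    Finset.card_pos.2 ⟨o, (Finset.mem_sdiff.1 hX'.top_mem).1⟩
  set S₁ := S.filter (fun v => (S.filter (r v)).card < X.card) with hS₁
  set S₂ := S.filter (fun v => (S.filter (fun w => r w v)).card < X.card) with hS₂
  have hcol₁ : Col r S₁ (2 * (X.card - 1) + 1) := by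
    refine Col.of_outdegree_le hirr S₁ fun v hv => ?_
    have h1 := (Finset.mem_filter.1 hv).2
    have h2 : (S₁.filter (r v)).card ≤ (S.filter (r v)).card :=
      Finset.card_le_card (Finset.filter_subset_filter _ (Finset.filter_subset _ _))
    omega
  have hcol₂ : Col r S₂ (2 * (X.card - 1) + 1) := by
    refine (Col.of_outdegree_le (r := flip r) (fun x => hirr x) S₂ fun v hv => ?_).of_flip
    have h1 := (Finset.mem_filter.1 hv).2
    have h2 : (S₂.filter (fun w => r w v)).card ≤ (S.filter (fun w => r w v)).card :=
      Finset.card_le_card (Finset.filter_subset_filter _ (Finset.filter_subset _ _))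
    exact Nat.le_sub_one_of_lt (h2.trans_lt h1)
  rcases h (S \ (S₁ ∪ S₂)) with ⟨f, hf⟩ | hcol
  swap
  · right
    refine ((hcol.union hcol₁).union hcol₂).mono ?_ (by omega)
    intro x hx
    simp only [Finset.mem_union, Finset.mem_sdiff]
    tauto
  left
  -- The leaves in `L` are placed one after the other.
  have key : ∀ M ⊆ L, ∃ f, IsEmb t r ((X \ L) ∪ M) S f ∧ ∀ x ∈ X \ L, f x ∈ S \ (S₁ ∪ S₂) := by
    intro M
    induction M using Finset.induction with
    | empty =>
      intro _
      exact ⟨f, hf.mono (by simp) Finset.sdiff_subset, hf.mem⟩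
    | insert x M hxM ih =>
      intro hML
      obtain ⟨f, hf, hfX⟩ := ih ((Finset.subset_insert x M).trans hML)
      have hxL : x ∈ L := hML (Finset.mem_insert_self x M)
      obtain ⟨hxo, hpx⟩ := hL x hxL
      set Z := (X \ L) ∪ M with hZ
      have hML' : ∀ y ∈ M, y ∈ L := fun y hy => hML (Finset.mem_insert_of_mem hy)
      have hxZ : x ∉ Z := by
        simp only [hZ, Finset.mem_union, Finset.mem_sdiff, not_or, not_and, not_not]
        exact ⟨fun _ => hxL, hxM⟩
      have hZcard : (Z.image f).card < X.card := by
        refine Finset.card_image_le.trans_lt (Finset.card_lt_card ⟨?_, ?_⟩)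
        · exact Finset.union_subset Finset.sdiff_subset fun y hy => hLX (hML' y hy)
        · exact fun hX => hxZ (hX (hLX hxL))
      have hnbr : ∀ y ∈ Z, t x y ∨ t y x → y = p x := by
        intro y hy hxy
        have hyx : ¬ (y ≠ o ∧ x = p y) := by
          rintro ⟨hyo, hxy⟩
          have : p y ∈ X \ L := by
            rcases Finset.mem_union.1 hy with h | h
            · exact hX'.parent_mem y h hyo
            · exact (hL y (hML' y h)).2
          rw [← hxy] at this
          exact (Finset.mem_sdiff.1 this).2 hxL
        rcases hxy with h | h
        · rcases ht.edge x y h with h | h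
          · exact absurd h hyx
          · exact h.2
        · rcases ht.edge y x h with h | h
          · exact h.2
          · exact absurd h hyx
      have hgood := hfX _ hpx
      rw [Finset.mem_sdiff, Finset.mem_union, not_or] at hgood
      obtain ⟨w, hwS, hwZ, h1, h2⟩ : ∃ w ∈ S, w ∉ Z.image f ∧ (t x (p x) → r w (f (p x))) ∧
          (t (p x) x → r (f (p x)) w) := by
        by_cases hdir : t x (p x)
        · have hdeg : X.card ≤ (S.filter (fun w => r w (f (p x)))).card := by
            by_contra hlt
            exact hgood.2.2 (Finset.mem_filter.2 ⟨hgood.1, not_le.1 hlt⟩)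
          obtain ⟨w, hw, hwZ⟩ := Finset.exists_mem_notMem_of_card_lt_card (hZcard.trans_le hdeg)
          rw [Finset.mem_filter] at hw
          exact ⟨w, hw.1, hwZ, fun _ => hw.2, fun h => absurd h (ht.asymm _ _ hdir)⟩
        · have hdeg : X.card ≤ (S.filter (r (f (p x)))).card := by
            by_contra hlt
            exact hgood.2.1 (Finset.mem_filter.2 ⟨hgood.1, not_le.1 hlt⟩)
          obtain ⟨w, hw, hwZ⟩ := Finset.exists_mem_notMem_of_card_lt_card (hZcard.trans_le hdeg)
          rw [Finset.mem_filter] at hw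
          exact ⟨w, hw.1, hwZ, fun h => absurd h hdir, fun _ => hw.2⟩
      refine ⟨Function.update f x w, ?_, ?_⟩
      · rw [Finset.union_insert]
        refine hf.insert_vertex ht.irrefl hxZ hwS
          (fun z hz h => hwZ (Finset.mem_image.2 ⟨z, hz, h⟩)) ?_ ?_
        · intro y hy hxy
          obtain rfl := hnbr y hy (Or.inl hxy)
          exact h1 hxy
        · intro y hy hxy
          obtain rfl := hnbr y hy (Or.inr hxy)
          exact h2 hxy
      · intro y hy
        rw [Function.update_of_ne (ne_of_mem_of_not_mem (Finset.mem_union_left M hy) hxZ)]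
        exact hfX y hy
  obtain ⟨f, hf, -⟩ := key L subset_rfl
  rw [Finset.sdiff_union_of_subset hLX] at hf
  exact ⟨f, hf⟩

/-! ### Trees with few leaves -/

/-- The vertices of `X` without a child in `X`. The root is not counted, even if it has degree one
in the tree. -/
noncomputable def leaves (o : W) (p : W → W) (X : Finset W) : Finset W :=
  X.filter (fun x => x ≠ o ∧ ∀ y ∈ X, y ≠ o → p y ≠ x)

lemma mem_leaves {X : Finset W} {x : W} :
    x ∈ leaves o p X ↔ x ∈ X ∧ x ≠ o ∧ ∀ y ∈ X, y ≠ o → p y ≠ x := by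
  simp [leaves]

lemma IsPendant.exists_leaf (ht : IsRooted t o p d) {X Y : Finset W} {q : W}
    (hY : IsPendant o p X q Y) : ∃ y ∈ Y, y ∈ leaves o p X := by
  obtain ⟨y, hy, hmax⟩ := Finset.exists_max_image Y d ⟨q, hY.subtree.top_mem⟩
  refine ⟨y, hy, mem_leaves.2 ⟨hY.subset hy, fun h => hY.root_notMem (h ▸ hy), ?_⟩⟩
  intro z hz hzo hzy
  have h1 := ht.depth_lt z hzo
  have h2 := hmax z (hY.child_mem z hz hzo (hzy ▸ hy))
  rw [hzy] at h1
  omega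

/-- A deepest vertex is a pendant subtree on its own. -/
lemma IsSubtree.exists_isPendant_singleton (ht : IsRooted t o p d) {X : Finset W}
    (hX : IsSubtree o p o X) (hne : X ≠ {o}) : ∃ q, IsPendant o p X q {q} := by
  obtain ⟨x, hx, hxo, hsub, -, -⟩ := hX.exists_leaf ht hne
  refine ⟨x, Finset.singleton_subset_iff.2 hx, hxo, ⟨Finset.mem_singleton_self x, ?_, ?_⟩, ?_⟩
  · exact fun y hy hyx => absurd (Finset.mem_singleton.1 hy) hyx
  · exact fun y hy hyx => absurd (Finset.mem_singleton.1 hy) hyx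
  · intro y hy hyo hpy
    by_contra hyx
    rw [Finset.mem_singleton] at hpy hyx
    have := hsub.parent_mem y (Finset.mem_erase.2 ⟨hyx, hy⟩) hyo
    rw [hpy] at this
    exact absurd this (Finset.notMem_erase x X)

/-- A largest pendant subtree `Y` among those with at most `s` vertices either has exactly `s`
vertices, or hangs at a vertex with another child, so that its removal destroys a leaf, or is
everything below the root. -/
lemma IsSubtree.exists_isPendant (ht : IsRooted t o p d) {X : Finset W}
    (hX : IsSubtree o p o X) (hne : X ≠ {o}) {s : ℕ} (hs : 1 ≤ s) :
    ∃ q Y, IsPendant o p X q Y ∧ Y.card ≤ s ∧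
      ((Y.card = s ∧ (leaves o p (X \ Y)).card ≤ (leaves o p X).card) ∨
        (leaves o p (X \ Y)).card + 1 ≤ (leaves o p X).card ∨ X \ Y = {o}) := by
  set F := X.powerset.filter (fun Y => Y.card ≤ s ∧ ∃ q, IsPendant o p X q Y) with hF
  have hFne : F.Nonempty := by
    obtain ⟨q, hq⟩ := hX.exists_isPendant_singleton ht hne
    exact ⟨{q}, Finset.mem_filter.2 ⟨Finset.mem_powerset.2 hq.subset, by simpa using hs, q, hq⟩⟩
  obtain ⟨Y, hYF, hmax⟩ := Finset.exists_max_image F Finset.card hFne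
  obtain ⟨-, hYs, q, hY⟩ := Finset.mem_filter.1 hYF
  refine ⟨q, Y, hY, hYs, ?_⟩
  have hqX := hY.subset hY.subtree.top_mem
  have hpqX : p q ∈ X := hX.parent_mem q hqX hY.top_ne
  have hpqY := hY.parent_notMem ht
  have hX' := hY.sdiff hX
  obtain ⟨y₀, hy₀Y, hy₀⟩ := hY.exists_leaf ht
  -- The only vertex that can become a leaf is the parent of `q`.
  have hleaf : ∀ x ∈ leaves o p (X \ Y), x ≠ p q → x ∈ (leaves o p X).erase y₀ := by
    intro x hx hxq
    rw [mem_leaves, Finset.mem_sdiff] at hx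
    refine Finset.mem_erase.2 ⟨fun h => hx.1.2 (h ▸ hy₀Y), mem_leaves.2 ⟨hx.1.1, hx.2.1, ?_⟩⟩
    intro z hz hzo hzx
    by_cases hzY : z ∈ Y
    · by_cases hzq : z = q
      · exact hxq (by rw [← hzx, hzq])
      · exact hx.1.2 (hzx ▸ hY.subtree.parent_mem z hzY hzq)
    · exact hx.2.2 z (Finset.mem_sdiff.2 ⟨hz, hzY⟩) hzo hzx
  have hcard : ((leaves o p X).erase y₀).card + 1 = (leaves o p X).card :=
    Finset.card_erase_add_one hy₀
  by_cases hchild : ∃ y ∈ X \ Y, y ≠ o ∧ p y = p q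
  · right
    left
    obtain ⟨y, hy, hyo, hyq⟩ := hchild
    have : leaves o p (X \ Y) ⊆ (leaves o p X).erase y₀ := fun x hx => by
      refine hleaf x hx fun h => ?_
      exact (mem_leaves.1 hx).2.2 y hy hyo (hyq.trans h.symm)
    have := Finset.card_le_card this
    omega
  push Not at hchild
  by_cases hpo : p q = o
  · right
    right
    by_contra hne'
    obtain ⟨x, hx, hxo⟩ : ∃ x ∈ X \ Y, x ≠ o := by
      by_contra hcon
      push Not at hcon
      exact hne' (Finset.eq_singleton_iff_unique_mem.2 ⟨hX'.top_mem, hcon⟩)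
    obtain ⟨m, hm, hmin⟩ := Finset.exists_min_image ((X \ Y).erase o) d
      ⟨x, Finset.mem_erase.2 ⟨hxo, hx⟩⟩
    rw [Finset.mem_erase] at hm
    by_cases hpm : p m = o
    · exact hchild m hm.2 hm.1 (hpm.trans hpo.symm)
    · have h1 := hmin _ (Finset.mem_erase.2 ⟨hpm, hX'.parent_mem m hm.2 hm.1⟩)
      have h2 := ht.depth_lt m hm.1
      omega
  · left
    have hpend : IsPendant o p X (p q) (insert (p q) Y) := by
      refine ⟨Finset.insert_subset hpqX hY.subset, hpo, ⟨Finset.mem_insert_self _ _, ?_, ?_⟩, ?_⟩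
      · intro x hx hxq h
        rcases Finset.mem_insert.1 hx with hx | hx
        · exact hxq hx
        · exact hY.root_notMem (h ▸ hx)
      · intro x hx hxq
        rcases Finset.mem_insert.1 hx with hx | hx
        · exact absurd hx hxq
        · by_cases h : x = q
          · rw [h]
            exact Finset.mem_insert_self _ _
          · exact Finset.mem_insert_of_mem (hY.subtree.parent_mem x hx h)
      · intro x hx hxo hpx
        refine Finset.mem_insert_of_mem ?_
        rcases Finset.mem_insert.1 hpx with h | h
        · by_contra hxY
          exact hchild x (Finset.mem_sdiff.2 ⟨hx, hxY⟩) hxo h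
        · exact hY.child_mem x hx hxo h
    have hcard' : (insert (p q) Y).card = Y.card + 1 := Finset.card_insert_of_notMem hpqY
    constructor
    · by_contra hlt
      have := hmax (insert (p q) Y) (Finset.mem_filter.2
        ⟨Finset.mem_powerset.2 hpend.subset, by omega, p q, hpend⟩)
      omega
    · have : leaves o p (X \ Y) ⊆ insert (p q) ((leaves o p X).erase y₀) := fun x hx => by
        by_cases h : x = p q
        · rw [h]
          exact Finset.mem_insert_self _ _
        · exact Finset.mem_insert_of_mem (hleaf x hx h)
      have h1 := Finset.card_le_card this
      have h2 := Finset.card_insert_le (p q) ((leaves o p X).erase y₀)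
      omega

/-- A tree with `ℓ` leaves is cut into at most `ℓ + |X| / s` pendant pieces of order at most `s`,
which are attached one by one. -/
lemma IsSubtree.unavoidable_of_pieces (ht : IsRooted t o p d) (hirr : ∀ x, ¬ r x x)
    {s : ℕ} (hs : 1 ≤ s) {k : ℕ} {X : Finset W} (hX : IsSubtree o p o X) (hk : X.card ≤ k) :
    ∃ n, Unavoidable t r X (k * n + (s - 1) * X.card) ∧
      s * n ≤ s * (leaves o p X).card + X.card := by
  induction hm : X.card using Nat.strong_induction_on generalizing X with
  | _ m ih =>
    by_cases hne : X = {o}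
    · refine ⟨0, fun S => ?_, by simp⟩
      rcases S.eq_empty_or_nonempty with rfl | ⟨v, hv⟩
      · exact Or.inr (Col.empty _)
      · subst hne
        exact Or.inl ⟨_, IsEmb.singleton ht.irrefl o hv⟩
    obtain ⟨q, Y, hY, hYs, hcases⟩ := hX.exists_isPendant ht hne hs
    have hcard : (X \ Y).card + Y.card = X.card :=
      Finset.card_sdiff_add_card_eq_card hY.subset
    have hYpos : 0 < Y.card := Finset.card_pos.2 ⟨q, hY.subtree.top_mem⟩
    have hlpos : 0 < (leaves o p X).card := by
      obtain ⟨y, -, hy⟩ := hY.exists_leaf ht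
      exact Finset.card_pos.2 ⟨y, hy⟩
    obtain ⟨n', hun, hn'⟩ := ih (X \ Y).card (by omega) (hY.sdiff hX) (by omega) rfl
    have hstep : ∀ n, Unavoidable t r (X \ Y) (k * n + (s - 1) * (X \ Y).card) →
        Unavoidable t r X (k * (n + 1) + (s - 1) * m) := by
      intro n h
      refine (hY.unavoidable ht hirr hX h).mono ?_
      have h1 : Y.card * (Y.card - 1) ≤ Y.card * (s - 1) := Nat.mul_le_mul_left _ (by omega)
      have h2 : X.card - 1 ≤ k := by omega
      rw [← hm, Nat.mul_succ]
      have h3 : (s - 1) * X.card = (s - 1) * ((X \ Y).card + Y.card) := by rw [hcard]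
      rw [h3, Nat.mul_add, Nat.mul_comm (s - 1) Y.card]
      omega
    rcases hcases with ⟨h1, h2⟩ | h | h
    · refine ⟨n' + 1, hstep _ hun, ?_⟩
      have := Nat.mul_le_mul_left s h2
      rw [Nat.mul_succ]
      omega
    · refine ⟨n' + 1, hstep _ hun, ?_⟩
      have := Nat.mul_le_mul_left s h
      rw [Nat.mul_succ] at this ⊢
      omega
    · refine ⟨0 + 1, hstep 0 ?_, ?_⟩
      · intro S
        rcases S.eq_empty_or_nonempty with rfl | ⟨v, hv⟩
        · exact Or.inr (Col.empty _)
        · rw [h]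
          exact Or.inl ⟨_, IsEmb.singleton ht.irrefl o hv⟩
      · have := Nat.mul_le_mul_left s hlpos
        omega

/-! ### The bound -/

/-- Removing `l` leaves from a tree of order `k` pays for the `4 k` colours that attaching them
costs, as soon as `l` is at least `√(5 / 6) √k`. -/
lemma four_mul_le_of_leaves {c b k k' l x y : ℝ} (hc : 0 ≤ c) (hx : 0 ≤ x)
    (hy : 0 ≤ y) (hxk : x ^ 2 = k) (hyk : y ^ 2 = k') (hkl : k = k' + l) (hl0 : 0 ≤ l)
    (hcb : c * b = 8 / 3) (hl : b * x ≤ l) :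
    c * k' * y + 11 / 3 * k' + 4 * k ≤ c * k * x + 11 / 3 * k := by
  subst hxk hyk
  have hl' : l = x ^ 2 - y ^ 2 := by linarith
  rcases hx.eq_or_lt with rfl | hx0
  · have : y = 0 := by nlinarith
    subst this
    simp
  have he : 0 ≤ l - b * x := by linarith
  have h1 : 0 ≤ c * (1 / 2 * y ^ 2 * (x - y) ^ 2) := by positivity
  have h2 : 0 ≤ c * x ^ 2 * (l - b * x) := by positivity
  have h3 : 0 ≤ 1 / 2 * c * (l - b * x) * y ^ 2 := by positivity
  have h4 : 0 ≤ 7 / 3 * x * l := by positivity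
  -- `x` times the difference of the two sides is the sum of these four terms.
  have hid : x * (c * x ^ 2 * x + 11 / 3 * x ^ 2 - (c * y ^ 2 * y + 11 / 3 * y ^ 2 + 4 * x ^ 2)) =
      c * (1 / 2 * y ^ 2 * (x - y) ^ 2) + c * x ^ 2 * (l - b * x) +
        1 / 2 * c * (l - b * x) * y ^ 2 + 7 / 3 * x * l := by
    subst hl'
    linear_combination (3 / 2 * x ^ 3 - 1 / 2 * (x ^ 2 - y ^ 2) * x) * hcb
  have h5 : 0 ≤ c * x ^ 2 * x + 11 / 3 * x ^ 2 -
      (c * y ^ 2 * y + 11 / 3 * y ^ 2 + 4 * x ^ 2) := by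
    refine le_of_mul_le_mul_left ?_ hx0
    rw [hid, mul_zero]
    linarith
  linarith

/-- Trees with many leaves are reduced by removing all of them; the others are cut into pieces of
order about `√k`. -/
lemma IsSubtree.exists_unavoidable (ht : IsRooted t o p d) (hirr : ∀ x, ¬ r x x) {X : Finset W}
    (hX : IsSubtree o p o X) :
    ∃ n : ℕ, Unavoidable t r X n ∧
      (n : ℝ) ≤ 8 * √(2 / 15) * X.card * √X.card + 11 / 3 * X.card := by
  have hcb : 8 * √(2 / 15) * √(5 / 6) = 8 / 3 := by
    rw [mul_assoc, ← Real.sqrt_mul (by norm_num)]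
    have : (2 / 15 * (5 / 6) : ℝ) = (1 / 3) ^ 2 := by norm_num
    rw [this, Real.sqrt_sq (by norm_num)]
    norm_num
  have hbc : √(5 / 6) + 2 ≤ 8 * √(2 / 15) := by
    have h1 : √(5 / 6) ≤ 0.913 := Real.sqrt_le_iff.2 (by norm_num)
    have h2 : 0.3651 ≤ √(2 / 15) := Real.le_sqrt_of_sq_le (by norm_num)
    linarith
  induction hm : X.card using Nat.strong_induction_on generalizing X with
  | _ m ih =>
    have hmpos : 0 < m := hm ▸ Finset.card_pos.2 ⟨o, hX.top_mem⟩
    have hx0 : 0 < √(m : ℝ) := Real.sqrt_pos.2 (by exact_mod_cast hmpos)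
    have hxm : √(m : ℝ) ^ 2 = m := Real.sq_sqrt (by positivity)
    by_cases hl : √(5 / 6) * √m ≤ ((leaves o p X).card : ℝ)
    · have hlpos : 0 < (leaves o p X).card := by
        have : (0 : ℝ) < √(5 / 6) * √m := by positivity
        exact_mod_cast this.trans_le hl
      have hsub : leaves o p X ⊆ X := Finset.filter_subset _ _
      have hcard : (X \ leaves o p X).card + (leaves o p X).card = X.card :=
        Finset.card_sdiff_add_card_eq_card hsub
      have hparent : ∀ x ∈ X, x ≠ o → p x ∈ X \ leaves o p X := fun x hx hxo =>
        Finset.mem_sdiff.2 ⟨hX.parent_mem x hx hxo, fun h => (mem_leaves.1 h).2.2 x hx hxo rfl⟩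
      have hX' : IsSubtree o p o (X \ leaves o p X) :=
        ⟨Finset.mem_sdiff.2 ⟨hX.top_mem, fun h => (mem_leaves.1 h).2.1 rfl⟩, fun x _ hx => hx,
          fun x hx hxo => hparent x (Finset.mem_sdiff.1 hx).1 hxo⟩
      obtain ⟨n, hn, hle⟩ := ih _ (by omega) hX' rfl
      refine ⟨n + 4 * m, ?_, ?_⟩
      · rw [← hm]
        exact hn.of_sdiff_leaves ht hirr hX' hsub fun x hx =>
          ⟨(mem_leaves.1 hx).2.1, hparent x (hsub hx) (mem_leaves.1 hx).2.1⟩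
      · have hkl : (m : ℝ) = (X \ leaves o p X).card + (leaves o p X).card := by
          rw [← hm, ← hcard]
          push_cast
          ring
        have := four_mul_le_of_leaves (c := 8 * √(2 / 15)) (by positivity)
          (Real.sqrt_nonneg m) (Real.sqrt_nonneg _) hxm (Real.sq_sqrt (Nat.cast_nonneg _)) hkl
          (Nat.cast_nonneg _) hcb hl
        push_cast
        linarith
    · rw [not_le] at hl
      set s := ⌈√(m : ℝ)⌉₊ with hs
      have hs1 : 1 ≤ s := Nat.ceil_pos.2 hx0
      have hsx : √(m : ℝ) ≤ s := Nat.le_ceil _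
      have hsx' : (s : ℝ) < √m + 1 := Nat.ceil_lt_add_one hx0.le
      obtain ⟨n, hun, hn⟩ := hX.unavoidable_of_pieces ht hirr hs1 hm.le
      rw [hm] at hun hn
      refine ⟨_, hun, ?_⟩
      have hn' : (s : ℝ) * n ≤ s * (leaves o p X).card + m := by exact_mod_cast hn
      have hnl : (n : ℝ) - (leaves o p X).card ≤ √m := by
        by_contra hlt
        rw [not_le] at hlt
        nlinarith
      have hfin : (m : ℝ) * n + (s - 1) * m ≤ (√(5 / 6) + 2) * m * √m := by
        have h1 : (n : ℝ) ≤ (√(5 / 6) + 1) * √m := by linarith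
        have h2 : (s : ℝ) - 1 ≤ √m := by linarith
        have h3 := mul_le_mul_of_nonneg_left h1 (Nat.cast_nonneg (α := ℝ) m)
        have h4 := mul_le_mul_of_nonneg_right h2 (Nat.cast_nonneg (α := ℝ) m)
        linarith
      have h5 : (√(5 / 6) + 2) * m * √m ≤ 8 * √(2 / 15) * m * √m := by gcongr
      have h6 : (0 : ℝ) ≤ 11 / 3 * m := by positivity
      push_cast [Nat.cast_sub hs1]
      linarith

/-- An oriented tree is rooted at a vertex `o` by the distances to `o`: the parent of a vertex is its
neighbour closer to `o`, which is unique because paths in a tree are. -/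
lemma exists_isRooted {T : Digraph W} (hT : T.IsOrientedTree) (o : W) :
    ∃ p d, IsRooted T.Adj o p d := by
  set G := T.toSimpleGraphInclusive with hG
  have htree : G.IsTree := hT.isTree
  have hex : ∀ x, x ≠ o → ∃ y, G.Adj x y ∧ G.dist x o = G.dist y o + 1 := by
    intro x hx
    obtain ⟨w, hw⟩ := htree.connected.exists_walk_length_eq_dist x o
    cases w with
    | nil => exact absurd rfl hx
    | @cons _ y _ h q =>
      refine ⟨y, h, ?_⟩
      have h1 : G.dist y o ≤ q.length := SimpleGraph.dist_le q
      have h2 := htree.dist_eq_dist_add_one_of_adj o h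
      rw [SimpleGraph.dist_comm (u := o), SimpleGraph.dist_comm (u := o)] at h2
      rw [SimpleGraph.Walk.length_cons] at hw
      omega
  have huniq : ∀ x y z, G.Adj x y → G.Adj x z → G.dist x o = G.dist y o + 1 →
      G.dist x o = G.dist z o + 1 → y = z := by
    intro x y z hy hz hdy hdz
    obtain ⟨u, hu⟩ := htree.connected.exists_walk_length_eq_dist y o
    obtain ⟨w, hw⟩ := htree.connected.exists_walk_length_eq_dist z o
    have h1 : (SimpleGraph.Walk.cons hy u).IsPath :=
      SimpleGraph.Walk.isPath_of_length_eq_dist _ (by rw [SimpleGraph.Walk.length_cons]; omega)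
    have h2 : (SimpleGraph.Walk.cons hz w).IsPath :=
      SimpleGraph.Walk.isPath_of_length_eq_dist _ (by rw [SimpleGraph.Walk.length_cons]; omega)
    have h3 := (htree.existsUnique_path x o).unique h1 h2
    simpa using congrArg SimpleGraph.Walk.snd h3
  choose! p hp using hex
  refine ⟨p, fun x => G.dist x o, fun x y h => hT.isOriented x y h, ?_, ?_⟩
  · intro x hx
    have := (hp x hx).2
    change G.dist (p x) o < G.dist x o
    omega
  · intro x y hxy
    have hadj : G.Adj x y :=
      ⟨fun h => hT.isOriented x y hxy (by rw [h] at hxy ⊢; exact hxy), Or.inl hxy⟩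
    have hne : ∀ u v, G.dist u o = G.dist v o + 1 → u ≠ o := by
      rintro u v h rfl
      rw [SimpleGraph.dist_self] at h
      omega
    have := htree.dist_eq_dist_add_one_of_adj o hadj
    rw [SimpleGraph.dist_comm (u := o), SimpleGraph.dist_comm (u := o)] at this
    rcases this with h | h
    · right
      have hxo := hne x y h
      exact ⟨hxo, huniq x y (p x) hadj (hp x hxo).1 h (hp x hxo).2⟩
    · left
      have hyo := hne y x h
      exact ⟨hyo, huniq y x (p y) hadj.symm (hp y hyo).1 h (hp y hyo).2⟩

/-- By compactness, a digraph all of whose finite parts can be coloured with `n` colours has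
chromatic number at most `n`. -/
lemma chromaticNumber_le_of_col (D : Digraph V) {n : ℕ} (h : ∀ S : Finset V, Col D.Adj S n) :
    D.chromaticNumber ≤ n := by
  refine SimpleGraph.Colorable.chromaticNumber_le ?_
  refine SimpleGraph.nonempty_hom_of_forall_finite_subgraph_hom fun G' hfin => ?_
  choose c hc1 hc2 using h
  have hmem : ∀ v : G'.verts, (v : V) ∈ hfin.toFinset := fun v => hfin.mem_toFinset.2 v.2
  refine ⟨fun v => ⟨c hfin.toFinset v, hc1 _ _ (hmem v)⟩, ?_⟩
  intro v w hvw
  have hne : c hfin.toFinset v ≠ c hfin.toFinset w := by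
    rcases (G'.adj_sub hvw).2 with h | h
    · exact hc2 _ _ (hmem v) _ (hmem w) h
    · exact (hc2 _ _ (hmem w) _ (hmem v) h).symm
  simpa [Fin.ext_iff] using hne

end OrientedTrees

theorem theorem1p3 (k : ℕ) (W : Type u) [Fintype W] (hk : Fintype.card W = k)
    (T : Digraph W) (hT : T.IsOrientedTree) :
    Digraph.IsUniversal.{v, u} T
      (8 * Real.sqrt (2 / 15) * (k : ℝ) * Real.sqrt k + 11 / 3 * (k : ℝ)
        + Real.sqrt (5 / 6) * Real.sqrt k + 1) := by
  intro V D hD hχ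
  by_contra hcon
  obtain ⟨o⟩ := hT.isTree.connected.nonempty
  obtain ⟨p, d, ht⟩ := OrientedTrees.exists_isRooted hT o
  have hX : OrientedTrees.IsSubtree o p o Finset.univ :=
    ⟨Finset.mem_univ _, fun _ _ h => h, fun _ _ _ => Finset.mem_univ _⟩
  obtain ⟨n, hn, hle⟩ := hX.exists_unavoidable (r := D.Adj) ht hD
  rw [Finset.card_univ, hk] at hle
  have hcol : D.chromaticNumber ≤ n := by
    refine OrientedTrees.chromaticNumber_le_of_col D fun S => (hn S).resolve_left ?_
    rintro ⟨f, hf⟩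
    exact hcon ⟨f, fun x y h => hf.inj x (Finset.mem_univ x) y (Finset.mem_univ y) h,
      fun x y => hf.map x (Finset.mem_univ x) y (Finset.mem_univ y)⟩
  have h1 : (D.chromaticNumber : ENNReal) ≤ ENNReal.ofReal n := by
    rw [ENNReal.ofReal_natCast]
    exact_mod_cast hcol
  have h2 := (ENNReal.ofReal_le_ofReal_iff (Nat.cast_nonneg n)).1 (hχ.trans h1)
  have h3 : 0 ≤ √(5 / 6) * √(k : ℝ) := by positivity
  linarith
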